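/- Let $\rho,\theta:\mathbb{R}^2\to\mathbb{R}$ be smooth with $\rho>0$ everywhere. For multi-indices $\boldsymbol\alpha=(\alpha_1,\alpha_2)$ let $a_{\boldsymbol\alpha},b_{\boldsymbol\alpha}$ be the functions of $q=(q_1,q_2)$ given by $a_{(0,0)}=\rho$, $b_{(0,0)}=0$ and, for $i=1,2$ and the unit multi-index $e_i$, $a_{\boldsymbol\alpha+e_i}=\partial_{q_i}a_{\boldsymbol\alpha}+(\partial_{q_i}\theta)b_{\boldsymbol\alpha}$, $b_{\boldsymbol\alpha+e_i}=\partial_{q_i}b_{\boldsymbol\alpha}-(\partial_{q_i}\theta)a_{\boldsymbol\alpha}$. For $n\ge1$ let $x_n,y_n,z_n,w_n$ be complex-valued functions of $(p,q)\in\mathbb{R}^2\times\mathbb{R}^2$ that are polynomials in $p=(p_1,p_2)$ of degree at most $n$ with coefficients smooth in $q$: $$x_n(p,q)=\sum_{m=0}^n\sum_{k=0}^m p_1^kp_2^{m-k}\,x_n^{k,m-k}(q),$$ and similarly for $y_n,z_n,w_n$; a coefficient $x_n^{A,B}$ (and likewise for $y,z,w$) is read as $0$ if $A<0$, $B<0$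 or $A+B>n$. Consider the following system (S). First, $x_1=z_1=w_1=0$ and $y_1=-\frac{i}{4\rho}(p_1\partial_{q_1}\theta+p_2\partial_{q_2}\theta)$; $y_n=0$ for $n$ even, and $x_n=z_n=w_n=0$ for $n$ odd. For every odd $n\ge1$, $$x_{n+1}=-\frac1{2\rho}\Big[\frac1i\,p\cdot\nabla_qy_n-2\sum_{j=1}^n\frac1{(2i)^jj!}\sum_{|\boldsymbol\alpha|=j}\partial_p^{\boldsymbol\alpha}\big(b_{\boldsymbol\alpha}z_{n+1-j}-a_{\boldsymbol\alpha}x_{n+1-j}\big)\Big],$$ and for every even $n\ge2$, $$y_{n+1}=-\frac1{2\rho}\Big[\frac1i\big(p\cdot\nabla_qx_n-z_n\,p\cdot\nabla_q\theta\big)-2\sum_{j=1}^n\frac1{(2i)^jj!}\sum_{|\boldsymbol\alpha|=j}\partial_p^{\boldsymbol\alpha}\big(-a_{\boldsymbol\alpha}y_{n+1-j}+b_{\boldsymbol\alpha}w_{n+1-j}\big)\Big],$$ $$\frac1i\big(p\cdot\nabla_qz_n+x_n\,p\cdot\nabla_q\theta\big)=2\sum_{j=1}^n\frac1{(2i)^jj!}\sum_{|\boldsymbol\alpha|=j}\partial_p^{\boldsymbol\alpha}\big(b_{\boldsymbol\alpha}y_{n+1-j}+a_{\boldsymbol\alpha}w_{n+1-j}\big),$$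 $$\frac1i\,p\cdot\nabla_qw_n=2\sum_{j=1}^n\frac1{(2i)^jj!}\sum_{|\boldsymbol\alpha|=j}\partial_p^{\boldsymbol\alpha}\big(a_{\boldsymbol\alpha}z_{n+1-j}+b_{\boldsymbol\alpha}x_{n+1-j}\big).$$ Then the functions $x_n,y_n,z_n,w_n$ satisfy (S) if and only if their coefficients satisfy the following system (R). First, $$x_1^{A,B}=z_1^{A,B}=w_1^{A,B}=0\ \ (A+B\in\{0,1\}),\qquad y_1^{0,0}=y_1^{1,1}=0,\quad y_1^{1,0}=-\frac{i}{4\rho}\partial_{q_1}\theta,\quad y_1^{0,1}=-\frac{i}{4\rho}\partial_{q_2}\theta;$$ $y_n^{A,B}=0$ for $n$ even, and $x_n^{A,B}=z_n^{A,B}=w_n^{A,B}=0$ for $n$ odd. Further, for $A,B\ge0$ with $A+B\le n+1$, writing $$\sum{}^{*}\,F_{\boldsymbol\alpha_j}^{\,n+1-j;\,A+\alpha,\,B+j-\alpha}:=\sum_{j=1}^{\lfloor (n+1-(A+B))/2\rfloor}\sum_{\alpha=0}^j\frac1{(2i)^jj!}\frac{(A+\alpha)!}{A!}\frac{(B+j-\alpha)!}{B!}\,F_{\boldsymbol\alpha_j}^{\,n+1-j;\,A+\alpha,\,B+j-\alpha},\qquad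 \boldsymbol\alpha_j=(\alpha,j-\alpha),$$ one has, for every odd $n\ge1$, $$x_{n+1}^{A,B}=-\frac1{2\rho}\Big[\frac1i\big(\partial_{q_1}y_n^{A-1,B}+\partial_{q_2}y_n^{A,B-1}\big)-2\sum{}^{*}\big(b_{\boldsymbol\alpha_j}z_{n+1-j}^{A+\alpha,B+j-\alpha}-a_{\boldsymbol\alpha_j}x_{n+1-j}^{A+\alpha,B+j-\alpha}\big)\Big],$$ and, for every even $n\ge2$, $$y_{n+1}^{A,B}=-\frac1{2\rho}\Big[\frac1i\big((\partial_{q_1}x_n^{A-1,B}+\partial_{q_2}x_n^{A,B-1})-(z_n^{A-1,B}\partial_{q_1}\theta+z_n^{A,B-1}\partial_{q_2}\theta)\big)-2\sum{}^{*}\big(-a_{\boldsymbol\alpha_j}y_{n+1-j}^{A+\alpha,B+j-\alpha}+b_{\boldsymbol\alpha_j}w_{n+1-j}^{A+\alpha,B+j-\alpha}\big)\Big],$$ $$0=\frac1i\big((\partial_{q_1}z_n^{A-1,B}+\partial_{q_2}z_n^{A,B-1})+(x_n^{A-1,B}\partial_{q_1}\theta+x_n^{A,B-1}\partial_{q_2}\theta)\big)-2\sum{}^{*}\big(b_{\boldsymbol\alpha_j}y_{n+1-j}^{A+\alpha,B+j-\alpha}+a_{\boldsymbol\alpha_j}w_{n+1-j}^{A+\alpha,B+j-\alpha}\big),$$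 $$0=\frac1i\big(\partial_{q_1}w_n^{A-1,B}+\partial_{q_2}w_n^{A,B-1}\big)-2\sum{}^{*}\big(a_{\boldsymbol\alpha_j}z_{n+1-j}^{A+\alpha,B+j-\alpha}+b_{\boldsymbol\alpha_j}x_{n+1-j}^{A+\alpha,B+j-\alpha}\big).$$ -/

import Mathlib

open scoped ContDiff

namespace Superadiabatic

/-- Partial derivative of a function on `ℝ²` in the first variable. -/
noncomputable def d₁ {E : Type*} [NormedAddCommGroup E] [NormedSpace ℝ E]
    (f : ℝ × ℝ → E) (q : ℝ × ℝ) : E :=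
  deriv (fun t : ℝ => f (t, q.2)) q.1

/-- Partial derivative of a function on `ℝ²` in the second variable. -/
noncomputable def d₂ {E : Type*} [NormedAddCommGroup E] [NormedSpace ℝ E]
    (f : ℝ × ℝ → E) (q : ℝ × ℝ) : E :=
  deriv (fun t : ℝ => f (q.1, t)) q.2

/-- The directional derivative `p · ∇_q f`, as a complex number, for complex `f`. -/
noncomputable def dirDeriv (p : ℝ × ℝ) (f : ℝ × ℝ → ℂ) (q : ℝ × ℝ) : ℂ :=
  (p.1 : ℂ) * d₁ f q + (p.2 : ℂ) * d₂ f q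

/-- The directional derivative `p · ∇_q θ` of the real function `θ`, as a complex number. -/
noncomputable def dirDerivReal (p : ℝ × ℝ) (θ : ℝ × ℝ → ℝ) (q : ℝ × ℝ) : ℂ :=
  (p.1 : ℂ) * ((d₁ θ q : ℝ) : ℂ) + (p.2 : ℂ) * ((d₂ θ q : ℝ) : ℂ)

/-- One step in the first index: `(a, b) ↦ (∂₁ a + (∂₁ θ) b, ∂₁ b - (∂₁ θ) a)`. -/
noncomputable def step₁ (θ : ℝ × ℝ → ℝ) (ab : (ℝ × ℝ → ℝ) × (ℝ × ℝ → ℝ)) :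
    (ℝ × ℝ → ℝ) × (ℝ × ℝ → ℝ) :=
  (fun q => d₁ ab.1 q + d₁ θ q * ab.2 q, fun q => d₁ ab.2 q - d₁ θ q * ab.1 q)

/-- One step in the second index: `(a, b) ↦ (∂₂ a + (∂₂ θ) b, ∂₂ b - (∂₂ θ) a)`. -/
noncomputable def step₂ (θ : ℝ × ℝ → ℝ) (ab : (ℝ × ℝ → ℝ) × (ℝ × ℝ → ℝ)) :
    (ℝ × ℝ → ℝ) × (ℝ × ℝ → ℝ) :=
  (fun q => d₂ ab.1 q + d₂ θ q * ab.2 q, fun q => d₂ ab.2 q - d₂ θ q * ab.1 q)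

/-- The pair `(a_α, b_α)`, `α = (α₁, α₂)`, started at `(ρ, 0)`. The second index is raised first;
`abCoeff_succ_right` below shows that for smooth data the recursion in the second index also holds
at every `α`, so that the order in which the indices are raised does not matter. -/
noncomputable def abCoeff (ρ θ : ℝ × ℝ → ℝ) : ℕ → ℕ → (ℝ × ℝ → ℝ) × (ℝ × ℝ → ℝ)
  | 0, 0 => (ρ, fun _ => 0)
  | 0, k + 1 => step₂ θ (abCoeff ρ θ 0 k)
  | j + 1, k => step₁ θ (abCoeff ρ θ j k)

/-- The function `a_α`. -/
noncomputable def aCoeff (ρ θ : ℝ × ℝ → ℝ) (α : ℕ × ℕ) : ℝ × ℝ → ℝ :=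
  (abCoeff ρ θ α.1 α.2).1

/-- The function `b_α`. -/
noncomputable def bCoeff (ρ θ : ℝ × ℝ → ℝ) (α : ℕ × ℕ) : ℝ × ℝ → ℝ :=
  (abCoeff ρ θ α.1 α.2).2

section Consistency

theorem d₁_eq_fderiv {f : ℝ × ℝ → ℝ} (hf : ContDiff ℝ ∞ f) :
    d₁ f = fun q => fderiv ℝ f q (1, 0) := by
  funext q
  have h1 : HasFDerivAt f (fderiv ℝ f q) ((fun t : ℝ => (t, q.2)) q.1) :=
    (hf.differentiable (by simp) q).hasFDerivAt
  have h2 : HasDerivAt (fun t : ℝ => (t, q.2)) ((1 : ℝ), (0 : ℝ)) q.1 :=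
    (hasDerivAt_id q.1).prodMk (hasDerivAt_const q.1 q.2)
  exact (h1.comp_hasDerivAt q.1 h2).deriv

theorem d₂_eq_fderiv {f : ℝ × ℝ → ℝ} (hf : ContDiff ℝ ∞ f) :
    d₂ f = fun q => fderiv ℝ f q (0, 1) := by
  funext q
  have h1 : HasFDerivAt f (fderiv ℝ f q) ((fun t : ℝ => (q.1, t)) q.2) :=
    (hf.differentiable (by simp) q).hasFDerivAt
  have h2 : HasDerivAt (fun t : ℝ => (q.1, t)) ((0 : ℝ), (1 : ℝ)) q.2 :=
    (hasDerivAt_const q.2 q.1).prodMk (hasDerivAt_id q.2)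
  exact (h1.comp_hasDerivAt q.2 h2).deriv

theorem contDiff_d₁ {f : ℝ × ℝ → ℝ} (hf : ContDiff ℝ ∞ f) : ContDiff ℝ ∞ (d₁ f) := by
  rw [d₁_eq_fderiv hf]
  exact (hf.fderiv_right (m := ∞) (by simp)).clm_apply contDiff_const

theorem contDiff_d₂ {f : ℝ × ℝ → ℝ} (hf : ContDiff ℝ ∞ f) : ContDiff ℝ ∞ (d₂ f) := by
  rw [d₂_eq_fderiv hf]
  exact (hf.fderiv_right (m := ∞) (by simp)).clm_apply contDiff_const

theorem d₁_d₂_comm {f : ℝ × ℝ → ℝ} (hf : ContDiff ℝ ∞ f) (q : ℝ × ℝ) :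
    d₁ (d₂ f) q = d₂ (d₁ f) q := by
  have hd : DifferentiableAt ℝ (fderiv ℝ f) q :=
    (hf.fderiv_right (m := ∞) (by simp)).differentiable (by simp) q
  rw [d₁_eq_fderiv (contDiff_d₂ hf), d₂_eq_fderiv (contDiff_d₁ hf), d₁_eq_fderiv hf,
    d₂_eq_fderiv hf]
  have h1 : fderiv ℝ (fun q => fderiv ℝ f q (0, 1)) q (1, 0)
      = fderiv ℝ (fderiv ℝ f) q (1, 0) (0, 1) := by
    rw [fderiv_clm_apply hd (differentiableAt_const _)]; simp
  have h2 : fderiv ℝ (fun q => fderiv ℝ f q (1, 0)) q (0, 1)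
      = fderiv ℝ (fderiv ℝ f) q (0, 1) (1, 0) := by
    rw [fderiv_clm_apply hd (differentiableAt_const _)]; simp
  have hs : IsSymmSndFDerivAt ℝ f q :=
    (hf.contDiffAt (x := q)).isSymmSndFDerivAt (by
      simpa [minSmoothness] using WithTop.coe_le_coe.2 (le_top : (2 : ℕ∞) ≤ ⊤))
  simp only [h1, h2]
  exact hs (1, 0) (0, 1)

theorem d₁_add_mul {f g h : ℝ × ℝ → ℝ} (hf : ContDiff ℝ ∞ f) (hg : ContDiff ℝ ∞ g)
    (hh : ContDiff ℝ ∞ h) (q : ℝ × ℝ) :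
    d₁ (fun q => f q + g q * h q) q = d₁ f q + (d₁ g q * h q + g q * d₁ h q) := by
  have s : ∀ {u : ℝ × ℝ → ℝ}, ContDiff ℝ ∞ u →
      DifferentiableAt ℝ (fun t : ℝ => u (t, q.2)) q.1 := fun hu =>
    ((hu.comp (contDiff_id.prodMk contDiff_const)).differentiable (by simp)) q.1
  exact ((s hf).hasDerivAt.add ((s hg).hasDerivAt.mul (s hh).hasDerivAt)).deriv

theorem d₂_add_mul {f g h : ℝ × ℝ → ℝ} (hf : ContDiff ℝ ∞ f) (hg : ContDiff ℝ ∞ g)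
    (hh : ContDiff ℝ ∞ h) (q : ℝ × ℝ) :
    d₂ (fun q => f q + g q * h q) q = d₂ f q + (d₂ g q * h q + g q * d₂ h q) := by
  have s : ∀ {u : ℝ × ℝ → ℝ}, ContDiff ℝ ∞ u →
      DifferentiableAt ℝ (fun t : ℝ => u (q.1, t)) q.2 := fun hu =>
    ((hu.comp (contDiff_const.prodMk contDiff_id)).differentiable (by simp)) q.2
  exact ((s hf).hasDerivAt.add ((s hg).hasDerivAt.mul (s hh).hasDerivAt)).deriv

theorem d₁_sub_mul {f g h : ℝ × ℝ → ℝ} (hf : ContDiff ℝ ∞ f) (hg : ContDiff ℝ ∞ g)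
    (hh : ContDiff ℝ ∞ h) (q : ℝ × ℝ) :
    d₁ (fun q => f q - g q * h q) q = d₁ f q - (d₁ g q * h q + g q * d₁ h q) := by
  have s : ∀ {u : ℝ × ℝ → ℝ}, ContDiff ℝ ∞ u →
      DifferentiableAt ℝ (fun t : ℝ => u (t, q.2)) q.1 := fun hu =>
    ((hu.comp (contDiff_id.prodMk contDiff_const)).differentiable (by simp)) q.1
  exact ((s hf).hasDerivAt.sub ((s hg).hasDerivAt.mul (s hh).hasDerivAt)).deriv

theorem d₂_sub_mul {f g h : ℝ × ℝ → ℝ} (hf : ContDiff ℝ ∞ f) (hg : ContDiff ℝ ∞ g)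
    (hh : ContDiff ℝ ∞ h) (q : ℝ × ℝ) :
    d₂ (fun q => f q - g q * h q) q = d₂ f q - (d₂ g q * h q + g q * d₂ h q) := by
  have s : ∀ {u : ℝ × ℝ → ℝ}, ContDiff ℝ ∞ u →
      DifferentiableAt ℝ (fun t : ℝ => u (q.1, t)) q.2 := fun hu =>
    ((hu.comp (contDiff_const.prodMk contDiff_id)).differentiable (by simp)) q.2
  exact ((s hf).hasDerivAt.sub ((s hg).hasDerivAt.mul (s hh).hasDerivAt)).deriv

theorem contDiff_abCoeff {ρ θ : ℝ × ℝ → ℝ} (hρ : ContDiff ℝ ∞ ρ) (hθ : ContDiff ℝ ∞ θ) :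
    ∀ j k : ℕ, ContDiff ℝ ∞ (abCoeff ρ θ j k).1 ∧ ContDiff ℝ ∞ (abCoeff ρ θ j k).2
  | 0, 0 => by
    rw [abCoeff]
    exact ⟨hρ, contDiff_const⟩
  | 0, k + 1 => by
    have ih := contDiff_abCoeff hρ hθ 0 k
    rw [abCoeff]
    exact ⟨(contDiff_d₂ ih.1).add ((contDiff_d₂ hθ).mul ih.2),
      (contDiff_d₂ ih.2).sub ((contDiff_d₂ hθ).mul ih.1)⟩
  | j + 1, k => by
    have ih := contDiff_abCoeff hρ hθ j k
    rw [abCoeff]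
    exact ⟨(contDiff_d₁ ih.1).add ((contDiff_d₁ hθ).mul ih.2),
      (contDiff_d₁ ih.2).sub ((contDiff_d₁ hθ).mul ih.1)⟩

theorem step_comm {θ : ℝ × ℝ → ℝ} (hθ : ContDiff ℝ ∞ θ) {ab : (ℝ × ℝ → ℝ) × (ℝ × ℝ → ℝ)}
    (ha : ContDiff ℝ ∞ ab.1) (hb : ContDiff ℝ ∞ ab.2) :
    step₁ θ (step₂ θ ab) = step₂ θ (step₁ θ ab) := by
  refine Prod.ext (funext fun q => ?_) (funext fun q => ?_)
  · simp only [step₁, step₂]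
    rw [d₁_add_mul (contDiff_d₂ ha) (contDiff_d₂ hθ) hb,
      d₂_add_mul (contDiff_d₁ ha) (contDiff_d₁ hθ) hb, d₁_d₂_comm ha, d₁_d₂_comm hθ]
    ring
  · simp only [step₁, step₂]
    rw [d₁_sub_mul (contDiff_d₂ hb) (contDiff_d₂ hθ) ha,
      d₂_sub_mul (contDiff_d₁ hb) (contDiff_d₁ hθ) ha, d₁_d₂_comm hb, d₁_d₂_comm hθ]
    ring

theorem abCoeff_succ_right {ρ θ : ℝ × ℝ → ℝ} (hρ : ContDiff ℝ ∞ ρ) (hθ : ContDiff ℝ ∞ θ)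
    (j k : ℕ) : abCoeff ρ θ j (k + 1) = step₂ θ (abCoeff ρ θ j k) := by
  induction j with
  | zero => rw [abCoeff]
  | succ j ih =>
    rw [abCoeff, ih, abCoeff]
    exact step_comm hθ (contDiff_abCoeff hρ hθ j k).1 (contDiff_abCoeff hρ hθ j k).2

end Consistency

/-- The sum `∑_{j=1}^{n} 1 / ((2i)^j j!) ∑_{|α|=j} ∂_p^α g_{α, n+1-j} (p)`, where `g α m` is a
function of the momentum `p`. -/
noncomputable def momentumSum (n : ℕ) (g : ℕ × ℕ → ℕ → ℝ × ℝ → ℂ) (p : ℝ × ℝ) : ℂ :=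
  ∑ j ∈ Finset.Icc 1 n, 1 / ((2 * Complex.I) ^ j * (j.factorial : ℂ)) *
    ∑ α ∈ Finset.HasAntidiagonal.antidiagonal j, (d₁^[α.1] (d₂^[α.2] (g α (n + 1 - j)))) p

/-- The algebraic-differential recursive system for the functions
`x_n(p, q), y_n(p, q), z_n(p, q), w_n(p, q)`, `n ≥ 1` (the arguments are `n p q`). -/
structure SymbolSystem (ρ θ : ℝ × ℝ → ℝ) (x y z w : ℕ → ℝ × ℝ → ℝ × ℝ → ℂ) : Prop where
  x_one : ∀ p q, x 1 p q = 0
  z_one : ∀ p q, z 1 p q = 0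
  w_one : ∀ p q, w 1 p q = 0
  y_one : ∀ p q, y 1 p q = -(Complex.I / (4 * (ρ q : ℂ))) * dirDerivReal p θ q
  y_even : ∀ n, 1 ≤ n → Even n → ∀ p q, y n p q = 0
  x_odd : ∀ n, Odd n → ∀ p q, x n p q = 0
  z_odd : ∀ n, Odd n → ∀ p q, z n p q = 0
  w_odd : ∀ n, Odd n → ∀ p q, w n p q = 0
  x_succ : ∀ n, Odd n → ∀ p q,
    x (n + 1) p q = -(1 / (2 * (ρ q : ℂ))) *
      (1 / Complex.I * dirDeriv p (y n p) q
        - 2 * momentumSum n (fun α m p' =>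
            (bCoeff ρ θ α q : ℂ) * z m p' q - (aCoeff ρ θ α q : ℂ) * x m p' q) p)
  y_succ : ∀ n, 1 ≤ n → Even n → ∀ p q,
    y (n + 1) p q = -(1 / (2 * (ρ q : ℂ))) *
      (1 / Complex.I * (dirDeriv p (x n p) q - z n p q * dirDerivReal p θ q)
        - 2 * momentumSum n (fun α m p' =>
            -(aCoeff ρ θ α q : ℂ) * y m p' q + (bCoeff ρ θ α q : ℂ) * w m p' q) p)
  z_eq : ∀ n, 1 ≤ n → Even n → ∀ p q,
    1 / Complex.I * (dirDeriv p (z n p) q + x n p q * dirDerivReal p θ q)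
      = 2 * momentumSum n (fun α m p' =>
            (bCoeff ρ θ α q : ℂ) * y m p' q + (aCoeff ρ θ α q : ℂ) * w m p' q) p
  w_eq : ∀ n, 1 ≤ n → Even n → ∀ p q,
    1 / Complex.I * dirDeriv p (w n p) q
      = 2 * momentumSum n (fun α m p' =>
            (aCoeff ρ θ α q : ℂ) * z m p' q + (bCoeff ρ θ α q : ℂ) * x m p' q) p

/-- `f_n(p, q) = ∑_{m=0}^{n} ∑_{k=0}^{m} p₁^k p₂^{m-k} c_n^{k, m-k}(q)` for `n ≥ 1`, with smooth
coefficients `c_n^{A, B}`, where `c_n^{A, B} = 0` if `A + B > n`. -/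
structure HasMomentumExpansion (f : ℕ → ℝ × ℝ → ℝ × ℝ → ℂ) (c : ℕ → ℕ → ℕ → ℝ × ℝ → ℂ) :
    Prop where
  smooth : ∀ n, 1 ≤ n → ∀ A B, ContDiff ℝ ∞ (c n A B)
  expand : ∀ n, 1 ≤ n → ∀ p q, f n p q =
    ∑ m ∈ Finset.range (n + 1), ∑ k ∈ Finset.range (m + 1),
      (p.1 : ℂ) ^ k * (p.2 : ℂ) ^ (m - k) * c n k (m - k) q
  degree : ∀ n, 1 ≤ n → ∀ A B, n < A + B → ∀ q, c n A B q = 0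

/-- `c^{A-1, B}`, read as `0` if `A = 0`. -/
def lower₁ (c : ℕ → ℕ → ℝ × ℝ → ℂ) : ℕ → ℕ → ℝ × ℝ → ℂ
  | 0, _ => fun _ => 0
  | A + 1, B => c A B

/-- `c^{A, B-1}`, read as `0` if `B = 0`. -/
def lower₂ (c : ℕ → ℕ → ℝ × ℝ → ℂ) : ℕ → ℕ → ℝ × ℝ → ℂ
  | _, 0 => fun _ => 0
  | A, B + 1 => c A B

/-- The sum `∑_{j=1}^{⌊(n+1-(A+B))/2⌋} ∑_{α=0}^{j} 1 / ((2i)^j j!) (A+α)!/A! (B+j-α)!/B!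
g_{(α, j-α), n+1-j}^{A+α, B+j-α}`. It is used only for `A + B ≤ n + 1`. -/
noncomputable def coeffSum (n A B : ℕ) (g : ℕ × ℕ → ℕ → ℕ → ℕ → ℂ) : ℂ :=
  ∑ j ∈ Finset.Icc 1 ((n + 1 - (A + B)) / 2), ∑ α ∈ Finset.range (j + 1),
    1 / ((2 * Complex.I) ^ j * (j.factorial : ℂ))
      * (((A + α).factorial : ℂ) / (A.factorial : ℂ))
      * (((B + (j - α)).factorial : ℂ) / (B.factorial : ℂ))
      * g (α, j - α) (n + 1 - j) (A + α) (B + (j - α))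

/-- The algebraic-differential recursive system for the coefficients
`x_n^{A,B}(q), y_n^{A,B}(q), z_n^{A,B}(q), w_n^{A,B}(q)` (the arguments are `n A B q`). -/
structure CoeffSystem (ρ θ : ℝ × ℝ → ℝ) (x y z w : ℕ → ℕ → ℕ → ℝ × ℝ → ℂ) : Prop where
  xzw_one : ∀ A B, A + B ≤ 1 → ∀ q, x 1 A B q = 0 ∧ z 1 A B q = 0 ∧ w 1 A B q = 0
  y_one_zero_zero : ∀ q, y 1 0 0 q = 0
  y_one_one_one : ∀ q, y 1 1 1 q = 0
  y_one_one_zero : ∀ q, y 1 1 0 q = -(Complex.I / (4 * (ρ q : ℂ))) * ((d₁ θ q : ℝ) : ℂ)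
  y_one_zero_one : ∀ q, y 1 0 1 q = -(Complex.I / (4 * (ρ q : ℂ))) * ((d₂ θ q : ℝ) : ℂ)
  y_even : ∀ n, 1 ≤ n → Even n → ∀ A B, A + B ≤ n → ∀ q, y n A B q = 0
  xzw_odd : ∀ n, Odd n → ∀ A B, A + B ≤ n → ∀ q,
    x n A B q = 0 ∧ z n A B q = 0 ∧ w n A B q = 0
  x_succ : ∀ n, Odd n → ∀ A B, A + B ≤ n + 1 → ∀ q,
    x (n + 1) A B q = -(1 / (2 * (ρ q : ℂ))) *
      (1 / Complex.I * (d₁ (lower₁ (y n) A B) q + d₂ (lower₂ (y n) A B) q)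
        - 2 * coeffSum n A B (fun α m A' B' =>
            (bCoeff ρ θ α q : ℂ) * z m A' B' q - (aCoeff ρ θ α q : ℂ) * x m A' B' q))
  y_succ : ∀ n, 1 ≤ n → Even n → ∀ A B, A + B ≤ n + 1 → ∀ q,
    y (n + 1) A B q = -(1 / (2 * (ρ q : ℂ))) *
      (1 / Complex.I * ((d₁ (lower₁ (x n) A B) q + d₂ (lower₂ (x n) A B) q)
          - (lower₁ (z n) A B q * ((d₁ θ q : ℝ) : ℂ) + lower₂ (z n) A B q * ((d₂ θ q : ℝ) : ℂ)))
        - 2 * coeffSum n A B (fun α m A' B' =>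
            -(aCoeff ρ θ α q : ℂ) * y m A' B' q + (bCoeff ρ θ α q : ℂ) * w m A' B' q))
  z_eq : ∀ n, 1 ≤ n → Even n → ∀ A B, A + B ≤ n + 1 → ∀ q,
    0 = 1 / Complex.I * ((d₁ (lower₁ (z n) A B) q + d₂ (lower₂ (z n) A B) q)
          + (lower₁ (x n) A B q * ((d₁ θ q : ℝ) : ℂ) + lower₂ (x n) A B q * ((d₂ θ q : ℝ) : ℂ)))
        - 2 * coeffSum n A B (fun α m A' B' =>
            (bCoeff ρ θ α q : ℂ) * y m A' B' q + (aCoeff ρ θ α q : ℂ) * w m A' B' q)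
  w_eq : ∀ n, 1 ≤ n → Even n → ∀ A B, A + B ≤ n + 1 → ∀ q,
    0 = 1 / Complex.I * (d₁ (lower₁ (w n) A B) q + d₂ (lower₂ (w n) A B) q)
        - 2 * coeffSum n A B (fun α m A' B' =>
            (aCoeff ρ θ α q : ℂ) * z m A' B' q + (bCoeff ρ θ α q : ℂ) * x m A' B' q)

end Superadiabatic

namespace Superadiabatic

open Finset Filter

/-! Fix `q`. Every equation of the symbol system is then an identity between two polynomial
functions of the real momentum `p`, and such an identity holds for all `p` exactly when all
coefficients agree (`HasCoeff.eq_iff`). The equivalence is therefore obtained equation by equation,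
without induction on `n`.

To read off coefficients, `HasCoeff` is shown to be stable under the operations that occur: linear
combinations, multiplication by `p₁` or `p₂` (an index shift, whence `lower₁` and `lower₂`), and
derivatives in `p` (an index shift with a quotient of factorials). Derivatives in `q` act on each
coefficient separately. Asking for the expansion for all large `M`, over a square of indices, lets
two polynomials be combined without matching their degrees.

The upper limit of `coeffSum` is a degree count, made in `HasCoeff.momentumSum`: in the `j`-th term,
the coefficient at `(A, B)` uses a coefficient of total degree `A + B + j` of a symbol of degree at
most `n + 1 - j`, which vanishes unless `2j ≤ n + 1 - (A + B)`. Finally, `forall_eq_iff_coeff`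
discards the indices beyond the degree bound, where both sides vanish. -/

/-- The function `f` of the momentum is the polynomial with coefficients `c A B`. -/
def HasCoeff (f : ℝ × ℝ → ℂ) (c : ℕ → ℕ → ℂ) : Prop :=
  ∀ᶠ M in atTop, (∀ A B, M ≤ A + B → c A B = 0) ∧
    ∀ p, f p = ∑ A ∈ range M, ∑ B ∈ range M, (p.1 : ℂ) ^ A * (p.2 : ℂ) ^ B * c A B

/-- A complex polynomial vanishing on the infinite set of real numbers is the zero polynomial. -/
theorem coeff_eq_zero_of_forall_real {a : ℕ → ℂ} {M : ℕ}
    (h : ∀ t : ℝ, ∑ A ∈ range M, (t : ℂ) ^ A * a A = 0) {A : ℕ} (hA : A < M) : a A = 0 := by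
  have hP : (∑ A ∈ range M, Polynomial.monomial A (a A) : Polynomial ℂ) = 0 := by
    refine Polynomial.eq_zero_of_infinite_isRoot _
      ((Set.infinite_range_of_injective Complex.ofReal_injective).mono ?_)
    rintro _ ⟨t, rfl⟩
    simp only [Set.mem_ofPred_eq, Polynomial.IsRoot, Polynomial.eval_finsetSum,
      Polynomial.eval_monomial, ← h t]
    exact sum_congr rfl fun _ _ => mul_comm _ _
  have := congrArg (fun P => Polynomial.coeff P A) hP
  simpa [Polynomial.finsetSum_coeff, Polynomial.coeff_monomial, hA] using this

/-! ### Coefficient calculus for polynomials in the momentum -/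

namespace HasCoeff

variable {f g : ℝ × ℝ → ℂ} {c d : ℕ → ℕ → ℂ}

theorem zero : HasCoeff (fun _ => 0) (fun _ _ => 0) := by simp [HasCoeff]

theorem add (hf : HasCoeff f c) (hg : HasCoeff g d) :
    HasCoeff (fun p => f p + g p) (fun A B => c A B + d A B) := by
  filter_upwards [hf, hg] with M h₁ h₂
  refine ⟨fun A B h => by rw [h₁.1 A B h, h₂.1 A B h, add_zero], fun p => ?_⟩
  simp only [h₁.2, h₂.2, mul_add, sum_add_distrib]

theorem const_mul (k : ℂ) (hf : HasCoeff f c) :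
    HasCoeff (fun p => k * f p) (fun A B => k * c A B) := by
  filter_upwards [hf] with M h
  refine ⟨fun A B hM => by rw [h.1 A B hM, mul_zero], fun p => ?_⟩
  simp only [h.2, mul_sum]
  exact sum_congr rfl fun _ _ => sum_congr rfl fun _ _ => by ring

theorem sub (hf : HasCoeff f c) (hg : HasCoeff g d) :
    HasCoeff (fun p => f p - g p) (fun A B => c A B - d A B) := by
  simpa [sub_eq_add_neg] using hf.add (hg.const_mul (-1))

theorem sum {ι : Type*} (s : Finset ι) {f : ι → ℝ × ℝ → ℂ} {c : ι → ℕ → ℕ → ℂ}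
    (h : ∀ i ∈ s, HasCoeff (f i) (c i)) :
    HasCoeff (fun p => ∑ i ∈ s, f i p) (fun A B => ∑ i ∈ s, c i A B) := by
  classical
  induction s using Finset.induction_on with
  | empty => simpa using zero
  | insert i s hi ih =>
    simp only [sum_insert hi]
    exact (h i (mem_insert_self i s)).add (ih fun j hj => h j (mem_insert_of_mem hj))

/-- The one-variable statement is applied twice: in the first momentum variable with the second
frozen, then in the second. -/
theorem eq_zero_iff (hf : HasCoeff f c) : (∀ p, f p = 0) ↔ ∀ A B, c A B = 0 := by
  obtain ⟨M, hM, hfM⟩ := hf.exists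
  refine ⟨fun h A B => ?_, fun h p => by simp [hfM, h]⟩
  by_cases hAB : A < M ∧ B < M
  · refine coeff_eq_zero_of_forall_real (M := M) (a := c A) (fun t => ?_) hAB.2
    refine coeff_eq_zero_of_forall_real (M := M)
      (a := fun A => ∑ B ∈ range M, (t : ℂ) ^ B * c A B) (fun s => ?_) hAB.1
    rw [← h (s, t), hfM]
    simp only [mul_sum, mul_assoc]
  · exact hM A B (by omega)

theorem eq_iff (hf : HasCoeff f c) (hg : HasCoeff g d) :
    (∀ p, f p = g p) ↔ ∀ A B, c A B = d A B := by
  simpa only [sub_eq_zero] using (hf.sub hg).eq_zero_iff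

/-- Symmetry device: each operation in the second variable is the conjugate by `swap` of the one in
the first. -/
theorem swap (hf : HasCoeff f c) : HasCoeff (fun p => f p.swap) (fun A B => c B A) := by
  filter_upwards [hf] with M h
  refine ⟨fun A B hM => h.1 B A (by omega), fun p => ?_⟩
  rw [h.2, sum_comm]
  exact sum_congr rfl fun _ _ => sum_congr rfl fun _ _ => by simp [mul_comm]

theorem fst_mul (hf : HasCoeff f c) :
    HasCoeff (fun p => (p.1 : ℂ) * f p) (fun A B => A.casesOn 0 fun A => c A B) := by
  -- Multiplication raises the degree by one, so bound `M` for `f` yields bound `M + 1` for the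
  -- product.
  rw [HasCoeff, ← map_add_atTop_eq_nat 1, eventually_map]
  filter_upwards [hf] with M h
  refine ⟨?_, fun p => ?_⟩
  · rintro (_ | A) B hM
    · rfl
    · exact h.1 A B (by omega)
  · rw [h.2, sum_range_succ', mul_sum]
    rw [sum_eq_zero (s := range (M + 1)) fun _ _ => mul_zero _, add_zero]
    refine sum_congr rfl fun A _ => ?_
    rw [sum_range_succ, mul_sum]
    dsimp only
    rw [h.1 A M (by omega), mul_zero, add_zero]
    exact sum_congr rfl fun _ _ => by ring

theorem d₁ (hf : HasCoeff f c) :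
    HasCoeff (d₁ f) (fun A B => ((A : ℂ) + 1) * c (A + 1) B) := by
  -- Differentiation consumes one power: `f` is expanded with bound `M + 1`, while the vanishing at
  -- bound `M` removes the extra column `B = M`.
  have hf' : ∀ᶠ M in atTop, _ := (tendsto_add_atTop_nat 1).eventually hf
  filter_upwards [hf, hf'] with M h h'
  refine ⟨fun A B hM => by rw [h.1 _ _ (by omega), mul_zero], fun p => ?_⟩
  have hd : HasDerivAt (fun t : ℝ => f (t, p.2)) (∑ A ∈ range (M + 1), ∑ B ∈ range (M + 1),
      ((A : ℂ) * (p.1 : ℂ) ^ (A - 1)) * (p.2 : ℂ) ^ B * c A B) p.1 := by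
    simp only [h'.2]
    refine HasDerivAt.fun_sum fun A _ => HasDerivAt.fun_sum fun B _ => ?_
    have := (hasDerivAt_pow A (p.1 : ℂ)).comp_ofReal
    exact (this.mul_const _).mul_const _
  rw [Superadiabatic.d₁, hd.deriv, sum_range_succ']
  simp only [Nat.cast_zero, zero_mul, sum_const_zero, add_zero]
  refine sum_congr rfl fun A _ => ?_
  rw [sum_range_succ, h.1 (A + 1) M (by omega), mul_zero, add_zero]
  refine sum_congr rfl fun B _ => ?_
  push_cast [Nat.add_sub_cancel]
  ring

theorem snd_mul (hf : HasCoeff f c) :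
    HasCoeff (fun p => (p.2 : ℂ) * f p) (fun A B => B.casesOn 0 fun B => c A B) :=
  hf.swap.fst_mul.swap

theorem d₂ (hf : HasCoeff f c) :
    HasCoeff (d₂ f) (fun A B => ((B : ℂ) + 1) * c A (B + 1)) :=
  hf.swap.d₁.swap

theorem iterate_d₁ (hf : HasCoeff f c) (k : ℕ) :
    HasCoeff (Superadiabatic.d₁^[k] f)
      (fun A B => ((A + k).factorial : ℂ) / (A.factorial : ℂ) * c (A + k) B) := by
  induction k with
  | zero => simpa [Nat.cast_ne_zero.2 (Nat.factorial_ne_zero _)] using hf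
  | succ k ih =>
    rw [Function.iterate_succ_apply']
    convert ih.d₁ using 3 with A B
    -- The new factor `A + 1` cancels against `(A + 1)! = (A + 1) * A!`.
    rw [show A + 1 + k = A + (k + 1) by ring, Nat.factorial_succ A]
    have h₁ : (A.factorial : ℂ) ≠ 0 := Nat.cast_ne_zero.2 (Nat.factorial_ne_zero _)
    have h₂ : (A : ℂ) + 1 ≠ 0 := Nat.cast_add_one_ne_zero A
    push_cast
    field_simp

theorem iterate_d₂ (hf : HasCoeff f c) (k : ℕ) :
    HasCoeff (Superadiabatic.d₂^[k] f)
      (fun A B => ((B + k).factorial : ℂ) / (B.factorial : ℂ) * c A (B + k)) := by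
  -- Conjugation by `swap` passes through the iterates.
  have key : ∀ g : ℝ × ℝ → ℂ, Superadiabatic.d₂^[k] g
      = fun p => (Superadiabatic.d₁^[k] fun p => g p.swap) p.swap := by
    induction k with
    | zero => intro g; rfl
    | succ k ih =>
      intro g
      rw [Function.iterate_succ_apply, ih]
      rfl
  rw [key]
  exact (hf.swap.iterate_d₁ k).swap

/-- Coefficients of the momentum sum, for symbols of degree `m` in the momentum. -/
theorem momentumSum {n : ℕ} (hn : 1 ≤ n) {g : ℕ × ℕ → ℕ → ℝ × ℝ → ℂ}
    {G : ℕ × ℕ → ℕ → ℕ → ℕ → ℂ} (h : ∀ α m, 1 ≤ m → HasCoeff (g α m) (G α m))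
    (hG : ∀ α m A B, 1 ≤ m → m < A + B → G α m A B = 0) :
    HasCoeff (momentumSum n g) (fun A B => coeffSum n A B G) := by
  have key := HasCoeff.sum (Icc 1 n) fun j hj =>
    (HasCoeff.sum (antidiagonal j) fun α _ => ((h α (n + 1 - j)
      (by have := mem_Icc.1 hj; omega)).iterate_d₂ α.2).iterate_d₁ α.1).const_mul
        (1 / ((2 * Complex.I) ^ j * (j.factorial : ℂ)))
  refine (congrArg _ (funext₂ fun A B => ?_)).mpr key
  rw [coeffSum]
  -- The short range of `j` lies in `Icc 1 n` because `1 ≤ n`; the added terms have to vanish.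
  refine (sum_congr rfl fun j hj => ?_).trans (sum_subset (Icc_subset_Icc_right (by omega)) ?_)
  · rw [Nat.sum_antidiagonal_eq_sum_range_succ_mk, mul_sum]
    exact sum_congr rfl fun _ _ => by ring
  · intro j hj hj'
    rw [mem_Icc] at hj hj'
    refine mul_eq_zero_of_right _ (sum_eq_zero fun α hα => ?_)
    rw [HasAntidiagonal.mem_antidiagonal] at hα
    -- Here `2j > n + 1 - (A + B)`, so the index sum `A + B + j` exceeds the degree `n + 1 - j`.
    rw [hG _ _ _ _ (by omega) (by omega), mul_zero, mul_zero]

end HasCoeff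

/-- Truncated subtraction makes the range of `j` equal to `Icc 1 0`, which is empty. -/
theorem coeffSum_eq_zero {n A B : ℕ} (h : n + 1 < A + B) (g : ℕ × ℕ → ℕ → ℕ → ℕ → ℂ) :
    coeffSum n A B g = 0 := by
  rw [coeffSum, show n + 1 - (A + B) = 0 by omega]
  rfl

/-! ### Coefficients of the terms built from the symbols -/

namespace HasMomentumExpansion

variable {f : ℕ → ℝ × ℝ → ℝ × ℝ → ℂ} {c : ℕ → ℕ → ℕ → ℝ × ℝ → ℂ}

theorem eq_sum_range (hf : HasMomentumExpansion f c) {n M : ℕ} (hn : 1 ≤ n) (hM : n + 1 ≤ M)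
    (p q : ℝ × ℝ) :
    f n p q = ∑ A ∈ range M, ∑ B ∈ range M, (p.1 : ℂ) ^ A * (p.2 : ℂ) ^ B * c n A B q := by
  rw [hf.expand n hn,
    sum_range_diag_flip (n + 1) fun A B => (p.1 : ℂ) ^ A * (p.2 : ℂ) ^ B * c n A B q]
  refine (sum_congr rfl fun A _ => ?_).trans
    (sum_subset (range_subset_range.2 hM) fun A _ hA => sum_eq_zero fun B _ => ?_)
  · refine sum_subset (range_subset_range.2 (by omega)) fun B _ hB => ?_
    rw [mem_range] at hB
    rw [hf.degree n hn A B (by omega), mul_zero]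
  · rw [mem_range] at hA
    rw [hf.degree n hn A B (by omega), mul_zero]

theorem hasCoeff (hf : HasMomentumExpansion f c) {n : ℕ} (hn : 1 ≤ n) (q : ℝ × ℝ) :
    HasCoeff (fun p => f n p q) (fun A B => c n A B q) := by
  filter_upwards [eventually_ge_atTop (n + 1)] with M hM
  exact ⟨fun A B h => hf.degree n hn A B (by omega) q, fun p => hf.eq_sum_range hn hM p q⟩

theorem coeff_eq_zero (hf : HasMomentumExpansion f c) {n : ℕ} (hn : 1 ≤ n) {A B : ℕ}
    (h : n < A + B) : c n A B = fun _ => 0 :=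
  funext (hf.degree n hn A B h)

/-- The derivative is in `q` with `p` a parameter, so the finite sum is differentiated term by term,
using smoothness of the coefficients. -/
theorem hasCoeff_d₁ (hf : HasMomentumExpansion f c) {n : ℕ} (hn : 1 ≤ n) (q : ℝ × ℝ) :
    HasCoeff (fun p => d₁ (f n p) q) (fun A B => d₁ (c n A B) q) := by
  filter_upwards [eventually_ge_atTop (n + 1)] with M hM
  refine ⟨fun A B h => by simp [hf.coeff_eq_zero hn (show n < A + B by omega), d₁], fun p => ?_⟩
  refine HasDerivAt.deriv ?_
  simp only [hf.eq_sum_range hn hM]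
  refine HasDerivAt.fun_sum fun A _ => HasDerivAt.fun_sum fun B _ => HasDerivAt.const_mul _ ?_
  exact ((((hf.smooth n hn A B).comp (contDiff_id.prodMk contDiff_const)).differentiable
    (by simp)) q.1).hasDerivAt

theorem hasCoeff_d₂ (hf : HasMomentumExpansion f c) {n : ℕ} (hn : 1 ≤ n) (q : ℝ × ℝ) :
    HasCoeff (fun p => d₂ (f n p) q) (fun A B => d₂ (c n A B) q) := by
  filter_upwards [eventually_ge_atTop (n + 1)] with M hM
  refine ⟨fun A B h => by simp [hf.coeff_eq_zero hn (show n < A + B by omega), d₂], fun p => ?_⟩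
  refine HasDerivAt.deriv ?_
  simp only [hf.eq_sum_range hn hM]
  refine HasDerivAt.fun_sum fun A _ => HasDerivAt.fun_sum fun B _ => HasDerivAt.const_mul _ ?_
  exact ((((hf.smooth n hn A B).comp (contDiff_const.prodMk contDiff_id)).differentiable
    (by simp)) q.2).hasDerivAt

theorem hasCoeff_dirDeriv (hf : HasMomentumExpansion f c) {n : ℕ} (hn : 1 ≤ n) (q : ℝ × ℝ) :
    HasCoeff (fun p => dirDeriv p (f n p) q)
      (fun A B => d₁ (lower₁ (c n) A B) q + d₂ (lower₂ (c n) A B) q) := by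
  refine (congrArg _ (funext₂ fun A B => ?_)).mpr
    ((hf.hasCoeff_d₁ hn q).fst_mul.add (hf.hasCoeff_d₂ hn q).snd_mul)
  cases A <;> cases B <;> simp [lower₁, lower₂, d₁, d₂]

theorem hasCoeff_mul_dirDerivReal (hf : HasMomentumExpansion f c) (θ : ℝ × ℝ → ℝ) {n : ℕ}
    (hn : 1 ≤ n) (q : ℝ × ℝ) :
    HasCoeff (fun p => f n p q * dirDerivReal p θ q)
      (fun A B => lower₁ (c n) A B q * ((d₁ θ q : ℝ) : ℂ)
        + lower₂ (c n) A B q * ((d₂ θ q : ℝ) : ℂ)) := by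
  convert ((hf.hasCoeff hn q).fst_mul.const_mul ((d₁ θ q : ℝ) : ℂ)).add
    ((hf.hasCoeff hn q).snd_mul.const_mul ((d₂ θ q : ℝ) : ℂ)) using 3 with p A B
  · rw [dirDerivReal]
    ring
  · cases A <;> cases B <;> simp [lower₁, lower₂, mul_comm]

theorem lower₁_eq_zero (hf : HasMomentumExpansion f c) {n : ℕ} (hn : 1 ≤ n) {A B : ℕ}
    (h : n + 1 < A + B) : lower₁ (c n) A B = fun _ => 0 := by
  cases A with
  | zero => rfl
  | succ A => exact hf.coeff_eq_zero hn (by omega)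

theorem lower₂_eq_zero (hf : HasMomentumExpansion f c) {n : ℕ} (hn : 1 ≤ n) {A B : ℕ}
    (h : n + 1 < A + B) : lower₂ (c n) A B = fun _ => 0 := by
  cases B with
  | zero => rfl
  | succ B => exact hf.coeff_eq_zero hn (by omega)

/-- At fixed `q` the functions `±a_α` and `±b_α` are constants in `p`; arbitrary weights `k`, `l`
cover all four equations. -/
theorem hasCoeff_momentumSum {u v : ℕ → ℝ × ℝ → ℝ × ℝ → ℂ} {cu cv : ℕ → ℕ → ℕ → ℝ × ℝ → ℂ}
    (hu : HasMomentumExpansion u cu) (hv : HasMomentumExpansion v cv) (k l : ℕ × ℕ → ℂ)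
    {n : ℕ} (hn : 1 ≤ n) (q : ℝ × ℝ) :
    HasCoeff (momentumSum n fun α m p => k α * u m p q + l α * v m p q)
      (fun A B => coeffSum n A B fun α m A' B' => k α * cu m A' B' q + l α * cv m A' B' q) :=
  .momentumSum hn
    (fun _ _ hm => ((hu.hasCoeff hm q).const_mul _).add ((hv.hasCoeff hm q).const_mul _))
    fun _ m A B hm h => by rw [hu.degree m hm A B h, hv.degree m hm A B h]; simp

theorem forall_eq_zero_iff (hf : HasMomentumExpansion f c) {n : ℕ} (hn : 1 ≤ n) :
    (∀ p q, f n p q = 0) ↔ ∀ A B, A + B ≤ n → ∀ q, c n A B q = 0 := by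
  rw [forall_comm]
  simp only [fun q => (hf.hasCoeff hn q).eq_zero_iff]
  refine ⟨fun h A B _ q => h q A B, fun h q A B => ?_⟩
  rcases le_or_gt (A + B) n with hAB | hAB
  · exact h A B hAB q
  · exact hf.degree n hn A B hAB q

end HasMomentumExpansion

/-- Comparison of coefficients of two families of polynomials of degree at most `N`. -/
theorem forall_eq_iff_coeff {F G : ℝ × ℝ → ℝ × ℝ → ℂ} {c d : ℕ → ℕ → ℝ × ℝ → ℂ} {N : ℕ}
    (hF : ∀ q, HasCoeff (fun p => F p q) fun A B => c A B q)
    (hG : ∀ q, HasCoeff (fun p => G p q) fun A B => d A B q)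
    (hcd : ∀ A B, N < A + B → ∀ q, c A B q = d A B q) :
    (∀ p q, F p q = G p q) ↔ ∀ A B, A + B ≤ N → ∀ q, c A B q = d A B q := by
  rw [forall_comm]
  simp only [fun q => (hF q).eq_iff (hG q)]
  refine ⟨fun h A B _ q => h q A B, fun h q A B => ?_⟩
  rcases le_or_gt (A + B) N with hAB | hAB
  · exact h A B hAB q
  · exact hcd A B hAB q

/-! ### Equivalence of the individual equations -/

section Equations

variable {ρ θ : ℝ × ℝ → ℝ} {x y z w : ℕ → ℝ × ℝ → ℝ × ℝ → ℂ}
  {cx cy cz cw : ℕ → ℕ → ℕ → ℝ × ℝ → ℂ}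

theorem x_succ_iff (hx : HasMomentumExpansion x cx) (hy : HasMomentumExpansion y cy)
    (hz : HasMomentumExpansion z cz) {n : ℕ} (hn : 1 ≤ n) :
    (∀ p q, x (n + 1) p q = -(1 / (2 * (ρ q : ℂ))) *
      (1 / Complex.I * dirDeriv p (y n p) q
        - 2 * momentumSum n (fun α m p' =>
            (bCoeff ρ θ α q : ℂ) * z m p' q - (aCoeff ρ θ α q : ℂ) * x m p' q) p)) ↔
    ∀ A B, A + B ≤ n + 1 → ∀ q,
      cx (n + 1) A B q = -(1 / (2 * (ρ q : ℂ))) *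
        (1 / Complex.I * (d₁ (lower₁ (cy n) A B) q + d₂ (lower₂ (cy n) A B) q)
          - 2 * coeffSum n A B (fun α m A' B' =>
              (bCoeff ρ θ α q : ℂ) * cz m A' B' q - (aCoeff ρ θ α q : ℂ) * cx m A' B' q)) := by
  refine forall_eq_iff_coeff (fun q => hx.hasCoeff (by omega) q)
    (fun q => (((hy.hasCoeff_dirDeriv hn q).const_mul _).sub
      (HasCoeff.const_mul _ ?_)).const_mul _) fun A B h q => ?_
  -- The difference is read as a sum with weight `-a_α` on `x`.
  · simpa only [neg_mul, ← sub_eq_add_neg] using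
      hz.hasCoeff_momentumSum hx (fun α => (bCoeff ρ θ α q : ℂ)) (fun α => -(aCoeff ρ θ α q : ℂ))
        hn q
  · rw [hx.degree _ (by omega) A B h, coeffSum_eq_zero h, hy.lower₁_eq_zero hn h,
      hy.lower₂_eq_zero hn h]
    simp [d₁, d₂]

theorem y_succ_iff (hx : HasMomentumExpansion x cx) (hy : HasMomentumExpansion y cy)
    (hz : HasMomentumExpansion z cz) (hw : HasMomentumExpansion w cw) {n : ℕ} (hn : 1 ≤ n) :
    (∀ p q, y (n + 1) p q = -(1 / (2 * (ρ q : ℂ))) *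
      (1 / Complex.I * (dirDeriv p (x n p) q - z n p q * dirDerivReal p θ q)
        - 2 * momentumSum n (fun α m p' =>
            -(aCoeff ρ θ α q : ℂ) * y m p' q + (bCoeff ρ θ α q : ℂ) * w m p' q) p)) ↔
    ∀ A B, A + B ≤ n + 1 → ∀ q,
      cy (n + 1) A B q = -(1 / (2 * (ρ q : ℂ))) *
        (1 / Complex.I * ((d₁ (lower₁ (cx n) A B) q + d₂ (lower₂ (cx n) A B) q)
            - (lower₁ (cz n) A B q * ((d₁ θ q : ℝ) : ℂ)
              + lower₂ (cz n) A B q * ((d₂ θ q : ℝ) : ℂ)))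
          - 2 * coeffSum n A B (fun α m A' B' =>
              -(aCoeff ρ θ α q : ℂ) * cy m A' B' q + (bCoeff ρ θ α q : ℂ) * cw m A' B' q)) := by
  refine forall_eq_iff_coeff (fun q => hy.hasCoeff (by omega) q)
    (fun q => ((((hx.hasCoeff_dirDeriv hn q).sub
      (hz.hasCoeff_mul_dirDerivReal θ hn q)).const_mul _).sub
      ((hy.hasCoeff_momentumSum hw (fun α => -(aCoeff ρ θ α q : ℂ))
        (fun α => (bCoeff ρ θ α q : ℂ)) hn q).const_mul _)).const_mul _) fun A B h q => ?_
  rw [hy.degree _ (by omega) A B h, coeffSum_eq_zero h, hx.lower₁_eq_zero hn h,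
    hx.lower₂_eq_zero hn h, hz.lower₁_eq_zero hn h, hz.lower₂_eq_zero hn h]
  simp [d₁, d₂]

theorem z_eq_iff (hx : HasMomentumExpansion x cx) (hy : HasMomentumExpansion y cy)
    (hz : HasMomentumExpansion z cz) (hw : HasMomentumExpansion w cw) {n : ℕ} (hn : 1 ≤ n) :
    (∀ p q, 1 / Complex.I * (dirDeriv p (z n p) q + x n p q * dirDerivReal p θ q)
      = 2 * momentumSum n (fun α m p' =>
            (bCoeff ρ θ α q : ℂ) * y m p' q + (aCoeff ρ θ α q : ℂ) * w m p' q) p) ↔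
    ∀ A B, A + B ≤ n + 1 → ∀ q,
      0 = 1 / Complex.I * ((d₁ (lower₁ (cz n) A B) q + d₂ (lower₂ (cz n) A B) q)
          + (lower₁ (cx n) A B q * ((d₁ θ q : ℝ) : ℂ) + lower₂ (cx n) A B q * ((d₂ θ q : ℝ) : ℂ)))
        - 2 * coeffSum n A B (fun α m A' B' =>
            (bCoeff ρ θ α q : ℂ) * cy m A' B' q + (aCoeff ρ θ α q : ℂ) * cw m A' B' q) := by
  simp only [eq_comm (a := (0 : ℂ)), sub_eq_zero]
  refine forall_eq_iff_coeff
    (fun q => ((hz.hasCoeff_dirDeriv hn q).add (hx.hasCoeff_mul_dirDerivReal θ hn q)).const_mul _)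
    (fun q => (hy.hasCoeff_momentumSum hw (fun α => (bCoeff ρ θ α q : ℂ))
      (fun α => (aCoeff ρ θ α q : ℂ)) hn q).const_mul _) fun A B h q => ?_
  rw [coeffSum_eq_zero h, hx.lower₁_eq_zero hn h, hx.lower₂_eq_zero hn h,
    hz.lower₁_eq_zero hn h, hz.lower₂_eq_zero hn h]
  simp [d₁, d₂]

theorem w_eq_iff (hx : HasMomentumExpansion x cx) (hz : HasMomentumExpansion z cz)
    (hw : HasMomentumExpansion w cw) {n : ℕ} (hn : 1 ≤ n) :
    (∀ p q, 1 / Complex.I * dirDeriv p (w n p) q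
      = 2 * momentumSum n (fun α m p' =>
            (aCoeff ρ θ α q : ℂ) * z m p' q + (bCoeff ρ θ α q : ℂ) * x m p' q) p) ↔
    ∀ A B, A + B ≤ n + 1 → ∀ q,
      0 = 1 / Complex.I * (d₁ (lower₁ (cw n) A B) q + d₂ (lower₂ (cw n) A B) q)
        - 2 * coeffSum n A B (fun α m A' B' =>
            (aCoeff ρ θ α q : ℂ) * cz m A' B' q + (bCoeff ρ θ α q : ℂ) * cx m A' B' q) := by
  simp only [eq_comm (a := (0 : ℂ)), sub_eq_zero]
  refine forall_eq_iff_coeff (fun q => (hw.hasCoeff_dirDeriv hn q).const_mul _)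
    (fun q => (hz.hasCoeff_momentumSum hx (fun α => (aCoeff ρ θ α q : ℂ))
      (fun α => (bCoeff ρ θ α q : ℂ)) hn q).const_mul _) fun A B h q => ?_
  rw [coeffSum_eq_zero h, hw.lower₁_eq_zero hn h, hw.lower₂_eq_zero hn h]
  simp [d₁, d₂]

theorem y_one_iff (hy : HasMomentumExpansion y cy) :
    (∀ p q, y 1 p q = -(Complex.I / (4 * (ρ q : ℂ))) * dirDerivReal p θ q) ↔
    ∀ q, cy 1 0 0 q = 0 ∧ cy 1 1 0 q = -(Complex.I / (4 * (ρ q : ℂ))) * ((d₁ θ q : ℝ) : ℂ) ∧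
      cy 1 0 1 q = -(Complex.I / (4 * (ρ q : ℂ))) * ((d₂ θ q : ℝ) : ℂ) := by
  have hexp : ∀ p q, y 1 p q
      = cy 1 0 0 q + (p.1 : ℂ) * cy 1 1 0 q + (p.2 : ℂ) * cy 1 0 1 q := fun p q => by
    rw [hy.expand 1 le_rfl]
    simp [sum_range_succ]
    ring
  simp only [hexp, dirDerivReal]
  constructor
  · intro h q
    -- A polynomial of degree at most one is determined by its values at the origin and the two unit
    -- vectors.
    have h₀ := h (0, 0) q
    have h₁ := h (1, 0) q
    have h₂ := h (0, 1) q
    simp only [Complex.ofReal_zero, Complex.ofReal_one, zero_mul, one_mul, add_zero,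
      mul_zero, zero_add] at h₀ h₁ h₂
    simp only [h₀, zero_add] at h₁ h₂
    exact ⟨h₀, h₁, h₂⟩
  · intro h p q
    rw [(h q).1, (h q).2.1, (h q).2.2]
    ring

end Equations

end Superadiabatic

/-! ### Assembly of the two systems -/

open Superadiabatic in
theorem proposition2 (ρ θ : ℝ × ℝ → ℝ)
    (hρ : ContDiff ℝ ∞ ρ) (hρ_pos : ∀ q, 0 < ρ q) (hθ : ContDiff ℝ ∞ θ)
    (x y z w : ℕ → ℝ × ℝ → ℝ × ℝ → ℂ)
    (cx cy cz cw : ℕ → ℕ → ℕ → ℝ × ℝ → ℂ)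
    (hx : Superadiabatic.HasMomentumExpansion x cx) (hy : Superadiabatic.HasMomentumExpansion y cy)
    (hz : Superadiabatic.HasMomentumExpansion z cz) (hw : Superadiabatic.HasMomentumExpansion w cw) :
    Superadiabatic.SymbolSystem ρ θ x y z w ↔ Superadiabatic.CoeffSystem ρ θ cx cy cz cw := by
  constructor
  · intro S
    have hy1 := (y_one_iff hy).1 S.y_one
    have xzw : ∀ n, Odd n → ∀ A B, A + B ≤ n → ∀ q,
        cx n A B q = 0 ∧ cz n A B q = 0 ∧ cw n A B q = 0 := fun n hn A B h q =>
      ⟨(hx.forall_eq_zero_iff hn.pos).1 (S.x_odd n hn) A B h q,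
        (hz.forall_eq_zero_iff hn.pos).1 (S.z_odd n hn) A B h q,
        (hw.forall_eq_zero_iff hn.pos).1 (S.w_odd n hn) A B h q⟩
    exact
      { xzw_one := xzw 1 odd_one
        y_one_zero_zero := fun q => (hy1 q).1
        -- This coefficient has total degree `2 > 1`, so it vanishes by the degree bound alone.
        y_one_one_one := hy.degree 1 le_rfl 1 1 (by norm_num)
        y_one_one_zero := fun q => (hy1 q).2.1
        y_one_zero_one := fun q => (hy1 q).2.2
        y_even := fun n hn he => (hy.forall_eq_zero_iff hn).1 (S.y_even n hn he)
        xzw_odd := xzw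
        x_succ := fun n hn => (x_succ_iff hx hy hz hn.pos).1 (S.x_succ n hn)
        y_succ := fun n hn he => (y_succ_iff hx hy hz hw hn).1 (S.y_succ n hn he)
        z_eq := fun n hn he => (z_eq_iff hx hy hz hw hn).1 (S.z_eq n hn he)
        w_eq := fun n hn he => (w_eq_iff hx hz hw hn).1 (S.w_eq n hn he) }
  · intro R
    have x_odd : ∀ n, Odd n → ∀ p q, x n p q = 0 := fun n hn =>
      (hx.forall_eq_zero_iff hn.pos).2 fun A B h q => (R.xzw_odd n hn A B h q).1
    have z_odd : ∀ n, Odd n → ∀ p q, z n p q = 0 := fun n hn =>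
      (hz.forall_eq_zero_iff hn.pos).2 fun A B h q => (R.xzw_odd n hn A B h q).2.1
    have w_odd : ∀ n, Odd n → ∀ p q, w n p q = 0 := fun n hn =>
      (hw.forall_eq_zero_iff hn.pos).2 fun A B h q => (R.xzw_odd n hn A B h q).2.2
    exact
      { x_one := x_odd 1 odd_one
        z_one := z_odd 1 odd_one
        w_one := w_odd 1 odd_one
        y_one := (y_one_iff hy).2 fun q =>
          ⟨R.y_one_zero_zero q, R.y_one_one_zero q, R.y_one_zero_one q⟩
        y_even := fun n hn he => (hy.forall_eq_zero_iff hn).2 (R.y_even n hn he)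
        x_odd := x_odd
        z_odd := z_odd
        w_odd := w_odd
        x_succ := fun n hn => (x_succ_iff hx hy hz hn.pos).2 (R.x_succ n hn)
        y_succ := fun n hn he => (y_succ_iff hx hy hz hw hn).2 (R.y_succ n hn he)
        z_eq := fun n hn he => (z_eq_iff hx hy hz hw hn).2 (R.z_eq n hn he)
        w_eq := fun n hn he => (w_eq_iff hx hz hw hn).2 (R.w_eq n hn he) }
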